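/- Let $E=(E^0,E^1,r,s)$ be a directed graph (sets of vertices and edges, with range and source maps $r,s:E^1\to E^0$; loops and multiple edges are allowed). A path is a vertex (path of length $0$) or a finite sequence of edges $e_1\cdots e_n$ with $r(e_i)=s(e_{i+1})$ for $1\le i<n$; $E$ is strongly connected if for all vertices $e,f$ there are a path from $e$ to $f$ and a path from $f$ to $e$. The graph inverse semigroup $G(E)$ is the semigroup with zero generated by $E^0$, $E^1$ and $E^{-1}=\{e^{-1}: e\in E^1\}$ subject to the relations, for $a,b\in E^0$ and $e,f\in E^1$: $a\cdot a=a$, and $a\cdot b=0$ if $a\ne b$; $s(e)\cdot e=e\cdot r(e)=e$; $e^{-1}\cdot s(e)=r(e)\cdot e^{-1}=e^{-1}$; $e^{-1}\cdot e=r(e)$, and $e^{-1}\cdot f=0$ if $e\neq f$. Concretely, its elements are $0$ and the formal products $uv^{-1}$ of paths $u,v$ with $r(u)=r(v)$, multiplied by $$u_1v_1^{-1}\cdot u_2v_2^{-1}=\begin{cases}u_1wv_2^{-1}, & u_2=v_1w \text{ for some path } w,\\ u_1(v_2w)^{-1}, & v_1=u_2w\text{ for some path } w,\\ 0,&\text{otherwise.}\end{cases}$$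 A topology on a semigroup $S$ is shift-continuous if for every $x\in S$ the maps $t\mapsto xt$ and $t\mapsto tx$ are continuous on $S$. **Theorem.** Let $E$ be a strongly connected directed graph with finitely many vertices (and an arbitrary set of edges). Then every Hausdorff, locally compact, shift-continuous topology on $G(E)$ is either compact or discrete. -/

import Mathlib

universe u v

namespace Quiver.Path

variable {V : Type u} [Quiver.{v} V]

/-- If two paths have a common extension, then one of them is a prefix of the other. -/
theorem prefix_or_prefix {a b c d : V} {p : Path a b} {q : Path a c}
    {x : Path b d} {y : Path c d} (h : p.comp x = q.comp y) :
    (∃ w : Path b c, q = p.comp w) ∨ ∃ w : Path c b, p = q.comp w := by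
  induction x with
  | nil => exact Or.inr ⟨y, h⟩
  | cons x e ih =>
    cases y with
    | nil => exact Or.inl ⟨x.cons e, h.symm⟩
    | cons y f =>
      simp only [comp_cons, cons.injEq] at h
      obtain ⟨rfl, h, -⟩ := h
      exact ih h.eq

end Quiver.Path

open Quiver in
/-- The graph inverse semigroup `G(E)` of a directed graph, the graph being given as a quiver with
vertex set `V` (an arrow `e : a ⟶ b` is an edge with source `a` and range `b`).
Its elements are `0` and the formal products `u v⁻¹`, where `u` and `v` are paths with the same
range; vertices are the paths of length zero. -/
inductive GraphInverseSemigroup (V : Type u) [Quiver.{v} V] : Type max u v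
  | zero : GraphInverseSemigroup V
  | mk {a b c : V} (u : Path a c) (v : Path b c) : GraphInverseSemigroup V

namespace GraphInverseSemigroup

open Quiver

variable {V : Type u} [Quiver.{v} V]

open scoped Classical in
/-- The product of `G(E)`: `u₁v₁⁻¹ · u₂v₂⁻¹` is `(u₁w)v₂⁻¹` if `u₂ = v₁w`, it is `u₁(v₂w)⁻¹` if
`v₁ = u₂w`, and it is `0` otherwise. Equality of paths includes equality of their sources, hence
the pairs. -/
noncomputable def mul : GraphInverseSemigroup V → GraphInverseSemigroup V → GraphInverseSemigroup V
  | @mk _ _ _ b₁ c₁ u₁ v₁, @mk _ _ a₂ _ c₂ u₂ v₂ =>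
    if h : ∃ w : Path c₁ c₂, (⟨a₂, u₂⟩ : Σ a, Path a c₂) = ⟨b₁, v₁.comp w⟩ then
      mk (u₁.comp h.choose) v₂
    else if h : ∃ w : Path c₂ c₁, (⟨b₁, v₁⟩ : Σ a, Path a c₁) = ⟨a₂, u₂.comp w⟩ then
      mk u₁ (v₂.comp h.choose)
    else zero
  | zero, _ => zero
  | mk _ _, zero => zero

noncomputable instance : Mul (GraphInverseSemigroup V) := ⟨mul⟩

instance : Zero (GraphInverseSemigroup V) := ⟨zero⟩

theorem mk_mul_mk_left {a b c d e : V} (u : Path a c) (v : Path b c) (w : Path c d)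
    (z : Path e d) : mk u v * mk (v.comp w) z = mk (u.comp w) z := by
  have h : ∃ w' : Path c d, (⟨b, v.comp w⟩ : Σ a, Path a d) = ⟨b, v.comp w'⟩ := ⟨w, rfl⟩
  have hw : h.choose = w :=
    (Path.comp_inj_right.1 (eq_of_heq (Sigma.mk.inj h.choose_spec).2)).symm
  change mul _ _ = _
  simp only [mul]
  rw [dif_pos h, hw]

theorem mk_mul_mk_right {a b c d e : V} (u : Path a d) (v : Path b c) (w : Path c d)
    (z : Path e c) : mk u (v.comp w) * mk v z = mk u (z.comp w) := by
  by_cases h : ∃ w' : Path d c, (⟨b, v⟩ : Σ a, Path a c) = ⟨b, (v.comp w).comp w'⟩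
  · obtain ⟨w', hw'⟩ := h
    simp only [Sigma.mk.injEq, heq_eq_eq, true_and] at hw'
    have hl := congrArg Path.length hw'
    simp only [Path.length_comp] at hl
    obtain rfl := Path.eq_of_length_zero w (by omega)
    obtain rfl := Path.eq_nil_of_length_zero w (by omega)
    simpa using mk_mul_mk_left u v Path.nil z
  · have h' : ∃ w' : Path c d, (⟨b, v.comp w⟩ : Σ a, Path a d) = ⟨b, v.comp w'⟩ := ⟨w, rfl⟩
    have hw : h'.choose = w :=
      (Path.comp_inj_right.1 (eq_of_heq (Sigma.mk.inj h'.choose_spec).2)).symm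
    change mul _ _ = _
    simp only [mul]
    rw [dif_neg h, dif_pos h', hw]

/-- One of the two paths is a prefix of the other. -/
def Comparable {a b c d : V} (p : Path a c) (q : Path b d) : Prop :=
  (∃ w : Path c d, (⟨b, q⟩ : Σ a, Path a d) = ⟨a, p.comp w⟩) ∨
    ∃ w : Path d c, (⟨a, p⟩ : Σ a, Path a c) = ⟨b, q.comp w⟩

theorem mk_mul_mk_of_not_comparable {a b c d e f : V} (u : Path a c) (v : Path b c) (x : Path d f)
    (y : Path e f) (h : ¬ Comparable v x) : mk u v * mk x y = 0 := by
  rw [Comparable, not_or] at h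
  change mul _ _ = _
  simp only [mul]
  rw [dif_neg h.1, dif_neg h.2]
  rfl

protected theorem zero_mul (x : GraphInverseSemigroup V) : 0 * x = 0 := rfl

protected theorem mul_zero (x : GraphInverseSemigroup V) : x * 0 = 0 := by
  cases x <;> rfl

theorem Comparable.elim {a b c d : V} {p : Path a c} {q : Path b d} (h : Comparable p q)
    {P : Prop} (h₁ : ∀ (_ : b = a) (w : Path c d), q ≍ p.comp w → P)
    (h₂ : ∀ (_ : a = b) (w : Path d c), p ≍ q.comp w → P) : P := by
  rcases h with ⟨w, h⟩ | ⟨w, h⟩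
  · simp only [Sigma.mk.injEq] at h
    exact h₁ h.1 w h.2
  · simp only [Sigma.mk.injEq] at h
    exact h₂ h.1 w h.2

theorem comparable_comp_left {a c d : V} (p : Path a c) (w : Path c d) :
    Comparable p (p.comp w) := Or.inl ⟨w, rfl⟩

theorem comparable_comp_right {a c d : V} (p : Path a c) (w : Path c d) :
    Comparable (p.comp w) p := Or.inr ⟨w, rfl⟩

theorem Comparable.symm {a b c d : V} {p : Path a c} {q : Path b d} (h : Comparable p q) :
    Comparable q p := Or.symm h

/-- A path comparable with `q w` is comparable with `q`. -/
theorem Comparable.of_comp {a b c d e : V} {p : Path a c} {q : Path b d} {w : Path d e}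
    (h : Comparable p (q.comp w)) : Comparable p q := by
  refine h.elim ?_ ?_
  · rintro rfl x hx
    rcases Path.prefix_or_prefix hx.eq with ⟨y, rfl⟩ | ⟨y, rfl⟩
    · exact comparable_comp_right _ _
    · exact comparable_comp_left _ _
  · rintro rfl x hx
    obtain rfl := hx.eq
    rw [Path.comp_assoc]
    exact comparable_comp_right _ _

theorem Comparable.of_comp_comp {a b c d : V} {p : Path a b} {w : Path b c} {x : Path b d}
    (h : Comparable (p.comp w) (p.comp x)) : Comparable w x := by
  refine h.elim ?_ ?_
  · rintro - y hy
    rw [Path.comp_assoc, heq_eq_eq, Path.comp_inj_right] at hy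
    exact hy ▸ comparable_comp_left _ _
  · rintro - y hy
    rw [Path.comp_assoc, heq_eq_eq, Path.comp_inj_right] at hy
    exact hy ▸ comparable_comp_right _ _

protected theorem mul_assoc (x y z : GraphInverseSemigroup V) : x * y * z = x * (y * z) := by
  have h0 : ∀ x : GraphInverseSemigroup V, 0 * x = 0 := GraphInverseSemigroup.zero_mul
  have h1 : ∀ x : GraphInverseSemigroup V, x * 0 = 0 := GraphInverseSemigroup.mul_zero
  rcases x with _ | ⟨u₁, v₁⟩
  · rfl
  rcases y with _ | ⟨u₂, v₂⟩
  · rfl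
  rcases z with _ | ⟨u₃, v₃⟩
  · exact (h1 _).trans ((congrArg _ (h1 _)).trans (h1 _)).symm
  by_cases h : Comparable v₁ u₂
  · by_cases h' : Comparable v₂ u₃
    · refine h.elim ?_ ?_
      · rintro rfl w hw
        obtain rfl := hw.eq
        refine h'.elim ?_ ?_
        · rintro rfl w' hw'
          obtain rfl := hw'.eq
          rw [mk_mul_mk_left, mk_mul_mk_left, mk_mul_mk_left, Path.comp_assoc, Path.comp_assoc,
            mk_mul_mk_left]
        · rintro rfl w' hw'
          obtain rfl := hw'.eq
          rw [mk_mul_mk_left, mk_mul_mk_right, mk_mul_mk_right, mk_mul_mk_left]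
      · rintro rfl w hw
        obtain rfl := hw.eq
        refine h'.elim ?_ ?_
        · rintro rfl w' hw'
          obtain rfl := hw'.eq
          rw [mk_mul_mk_right, mk_mul_mk_left]
          by_cases hc : Comparable w w'
          · refine hc.elim ?_ ?_
            · rintro - y hy
              obtain rfl := hy.eq
              rw [← Path.comp_assoc, ← Path.comp_assoc, mk_mul_mk_left, mk_mul_mk_left]
            · rintro - y hy
              obtain rfl := hy.eq
              rw [← Path.comp_assoc, ← Path.comp_assoc, mk_mul_mk_right, mk_mul_mk_right]
          · rw [mk_mul_mk_of_not_comparable _ _ _ _ fun h => hc h.of_comp_comp,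
              mk_mul_mk_of_not_comparable _ _ _ _ fun h => hc h.of_comp_comp]
        · rintro rfl w' hw'
          obtain rfl := hw'.eq
          rw [mk_mul_mk_right, mk_mul_mk_right, Path.comp_assoc, mk_mul_mk_right, mk_mul_mk_right,
            Path.comp_assoc]
    · rw [mk_mul_mk_of_not_comparable _ _ _ _ h', h1]
      refine h.elim ?_ ?_
      · rintro rfl w hw
        obtain rfl := hw.eq
        rw [mk_mul_mk_left, mk_mul_mk_of_not_comparable _ _ _ _ h']
      · rintro rfl w hw
        obtain rfl := hw.eq
        rw [mk_mul_mk_right,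
          mk_mul_mk_of_not_comparable _ _ _ _ fun hc => h' hc.symm.of_comp.symm]
  · -- the left-hand pair multiplies to zero
    rw [mk_mul_mk_of_not_comparable _ _ _ _ h, h0]
    by_cases h' : Comparable v₂ u₃
    · refine h'.elim ?_ ?_
      · rintro rfl w hw
        obtain rfl := hw.eq
        rw [mk_mul_mk_left, mk_mul_mk_of_not_comparable _ _ _ _ fun hc => h hc.of_comp]
      · rintro rfl w hw
        obtain rfl := hw.eq
        rw [mk_mul_mk_right, mk_mul_mk_of_not_comparable _ _ _ _ h]
    · rw [mk_mul_mk_of_not_comparable _ _ _ _ h', h1]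

noncomputable instance : SemigroupWithZero (GraphInverseSemigroup V) where
  mul_assoc := GraphInverseSemigroup.mul_assoc
  zero_mul := GraphInverseSemigroup.zero_mul
  mul_zero := GraphInverseSemigroup.mul_zero

/-! ### The presentation by generators and relations -/

/-- The defining relations of `G(E)`, for elements `p a`, `x e`, `y e` of a semigroup with zero
that are the values of the vertices `a`, of the edges `e` and of the formal inverses `e⁻¹`. -/
structure Relations {S : Type*} [SemigroupWithZero S] (p : V → S)
    (x y : ∀ ⦃a b : V⦄, (a ⟶ b) → S) : Prop where
  vertex_mul_self (a : V) : p a * p a = p a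
  vertex_mul_of_ne {a b : V} : a ≠ b → p a * p b = 0
  source_mul {a b : V} (e : a ⟶ b) : p a * x e = x e
  mul_range {a b : V} (e : a ⟶ b) : x e * p b = x e
  inv_mul_source {a b : V} (e : a ⟶ b) : y e * p a = y e
  range_mul_inv {a b : V} (e : a ⟶ b) : p b * y e = y e
  inv_mul_self {a b : V} (e : a ⟶ b) : y e * x e = p b
  inv_mul_of_ne {a b c d : V} (e : a ⟶ b) (f : c ⟶ d) :
    (⟨a, b, e⟩ : Total V) ≠ ⟨c, d, f⟩ → y e * x f = 0

/-- A vertex as an element of `G(E)`. -/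
def vertex (a : V) : GraphInverseSemigroup V := mk (Path.nil : Path a a) Path.nil

/-- An edge as an element of `G(E)`. -/
def edge ⦃a b : V⦄ (e : a ⟶ b) : GraphInverseSemigroup V := mk e.toPath Path.nil

/-- The inverse of an edge as an element of `G(E)`. -/
def edgeInv ⦃a b : V⦄ (e : a ⟶ b) : GraphInverseSemigroup V := mk Path.nil e.toPath

/-- `G(E)` satisfies the defining relations. -/
theorem relations : Relations (vertex (V := V)) edge edgeInv where
  vertex_mul_self a := mk_mul_mk_left _ _ Path.nil _
  vertex_mul_of_ne {a b} h := mk_mul_mk_of_not_comparable _ _ _ _ fun hc =>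
    hc.elim (fun h' _ _ => h h'.symm) (fun h' _ _ => h h')
  source_mul {a b} e := by
    simpa [vertex, edge, Hom.toPath] using
      mk_mul_mk_left (Path.nil : Path a a) Path.nil e.toPath Path.nil
  mul_range {a b} e := mk_mul_mk_left e.toPath (Path.nil : Path b b) Path.nil Path.nil
  inv_mul_source {a b} e := by
    simpa [vertex, edgeInv, Hom.toPath] using
      mk_mul_mk_right Path.nil (Path.nil : Path a a) e.toPath Path.nil
  range_mul_inv {a b} e := mk_mul_mk_left (Path.nil : Path b b) Path.nil Path.nil e.toPath
  inv_mul_self {a b} e := mk_mul_mk_left (Path.nil : Path b b) e.toPath Path.nil Path.nil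
  inv_mul_of_ne {a b c d} e f h := by
    refine mk_mul_mk_of_not_comparable _ _ _ _ fun hc => hc.elim ?_ ?_
    · rintro rfl w hw
      cases w with
      | nil => cases hw; exact h rfl
      | cons w g => have := congrArg Path.length hw.eq; simp at this
    · rintro rfl w hw
      cases w with
      | nil => cases hw; exact h rfl
      | cons w g => have := congrArg Path.length hw.eq; simp at this

section Lift

variable {S : Type*} [SemigroupWithZero S]

/-- The value `x e₁ ⋯ x eₙ` of the path `e₁ … eₙ`. -/
def pathValue (p : V → S) (x : ∀ ⦃a b : V⦄, (a ⟶ b) → S) {a : V} : ∀ {b : V}, Path a b → S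
  | _, Path.nil => p a
  | _, Path.cons q e => pathValue p x q * x e

/-- The value `y eₙ ⋯ y e₁` of the inverse of the path `e₁ … eₙ`. -/
def invPathValue (p : V → S) (y : ∀ ⦃a b : V⦄, (a ⟶ b) → S) {a : V} : ∀ {b : V}, Path a b → S
  | _, Path.nil => p a
  | _, Path.cons q e => y e * invPathValue p y q

variable {p : V → S} {x y : ∀ ⦃a b : V⦄, (a ⟶ b) → S}

namespace Relations

theorem vertex_mul_pathValue (H : Relations p x y) {a b : V} (q : Path a b) :
    p a * pathValue p x q = pathValue p x q := by
  induction q with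
  | nil => exact H.vertex_mul_self a
  | cons q e ih => rw [pathValue, ← mul_assoc, ih]

theorem pathValue_mul_vertex (H : Relations p x y) {a b : V} (q : Path a b) :
    pathValue p x q * p b = pathValue p x q := by
  cases q with
  | nil => exact H.vertex_mul_self a
  | cons q e => rw [pathValue, mul_assoc, H.mul_range]

theorem invPathValue_mul_vertex (H : Relations p x y) {a b : V} (q : Path a b) :
    invPathValue p y q * p a = invPathValue p y q := by
  induction q with
  | nil => exact H.vertex_mul_self a
  | cons q e ih => rw [invPathValue, mul_assoc, ih]

theorem vertex_mul_invPathValue (H : Relations p x y) {a b : V} (q : Path a b) :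
    p b * invPathValue p y q = invPathValue p y q := by
  cases q with
  | nil => exact H.vertex_mul_self a
  | cons q e => rw [invPathValue, ← mul_assoc, H.range_mul_inv]

theorem pathValue_comp (H : Relations p x y) {a b c : V} (q : Path a b) (w : Path b c) :
    pathValue p x (q.comp w) = pathValue p x q * pathValue p x w := by
  induction w with
  | nil => exact (H.pathValue_mul_vertex q).symm
  | cons w e ih => rw [Path.comp_cons, pathValue, pathValue, ih, mul_assoc]

theorem invPathValue_comp (H : Relations p x y) {a b c : V} (q : Path a b) (w : Path b c) :
    invPathValue p y (q.comp w) = invPathValue p y w * invPathValue p y q := by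
  induction w with
  | nil => exact (H.vertex_mul_invPathValue q).symm
  | cons w e ih => rw [Path.comp_cons, invPathValue, invPathValue, ih, mul_assoc]

theorem invPathValue_mul_pathValue (H : Relations p x y) {a b : V} (q : Path a b) :
    invPathValue p y q * pathValue p x q = p b := by
  induction q with
  | nil => exact H.vertex_mul_self a
  | cons q e ih =>
    rw [invPathValue, pathValue, mul_assoc, ← mul_assoc _ _ (x e), ih, H.source_mul,
      H.inv_mul_self]

theorem invPathValue_mul_pathValue_of_not_comparable (H : Relations p x y)
    {a b c d : V} (q : Path a b) (r : Path c d)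
    (h : ¬ Comparable q r) : invPathValue p y q * pathValue p x r = 0 := by
  by_cases hac : a = c
  · subst hac
    induction r with
    | nil => exact absurd (by simpa using comparable_comp_right Path.nil q) h
    | cons r e ih =>
      rw [pathValue, ← mul_assoc]
      by_cases hr : Comparable q r
      · refine hr.elim ?_ ?_
        · rintro - w hw
          obtain rfl := hw.eq
          exact absurd (comparable_comp_left q (w.cons e)) h
        · rintro - w hw
          obtain rfl := hw.eq
          rw [H.invPathValue_comp, mul_assoc _ _ (pathValue p x r), H.invPathValue_mul_pathValue,
            H.invPathValue_mul_vertex]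
          -- the first edge of `w` differs from `e`
          rcases Nat.eq_zero_or_pos w.length with hl | hl
          · obtain rfl := Path.eq_of_length_zero w hl
            obtain rfl := Path.eq_nil_of_length_zero w hl
            exact absurd (comparable_comp_left r e.toPath) h
          · obtain ⟨b', g, w', rfl, -⟩ := (Path.length_ne_zero_iff_eq_comp w).1 hl.ne'
            have hge : (⟨_, _, g⟩ : Total V) ≠ ⟨_, _, e⟩ := by
              intro hge
              cases hge
              rw [← Path.comp_assoc] at h
              exact h (comparable_comp_right _ _)
            rw [H.invPathValue_comp, mul_assoc]
            have : invPathValue p y g.toPath = y g := H.inv_mul_source g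
            rw [this, H.inv_mul_of_ne _ _ hge, mul_zero]
      · rw [ih hr, zero_mul]
  · rw [← H.invPathValue_mul_vertex, ← H.vertex_mul_pathValue, mul_assoc, ← mul_assoc (p a),
      H.vertex_mul_of_ne hac, zero_mul, mul_zero]

end Relations

/-- `G(E)` is the semigroup with zero presented by the generators `a ∈ E⁰`, `e`, `e⁻¹` (`e ∈ E¹`)
and the defining relations. -/
theorem existsUnique_lift (H : Relations p x y) :
    ∃! f : GraphInverseSemigroup V →ₙ* S, f 0 = 0 ∧ (∀ a, f (vertex a) = p a) ∧
      ∀ ⦃a b : V⦄ (e : a ⟶ b), f (edge e) = x e ∧ f (edgeInv e) = y e := by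
  let F : GraphInverseSemigroup V → S
    | zero => 0
    | mk u v => pathValue p x u * invPathValue p y v
  have hF : ∀ g h, F (g * h) = F g * F h := by
    rintro (_ | ⟨u₁, v₁⟩) (_ | ⟨u₂, v₂⟩)
    · exact (zero_mul _).symm
    · exact (zero_mul _).symm
    · exact (mul_zero _).symm
    by_cases hc : Comparable v₁ u₂
    · refine hc.elim ?_ ?_
      · rintro rfl w hw
        obtain rfl := hw.eq
        rw [mk_mul_mk_left]
        change pathValue p x _ * _ = (_ * _) * (pathValue p x _ * _)
        rw [H.pathValue_comp, H.pathValue_comp, mul_assoc (pathValue p x v₁), mul_assoc _ _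
          (pathValue p x v₁ * _), ← mul_assoc (invPathValue p y v₁), H.invPathValue_mul_pathValue,
          ← mul_assoc (p _), H.vertex_mul_pathValue, mul_assoc]
      · rintro rfl w hw
        obtain rfl := hw.eq
        rw [mk_mul_mk_right]
        change _ * invPathValue p y _ = (_ * invPathValue p y _) * (_ * _)
        rw [H.invPathValue_comp, H.invPathValue_comp, mul_assoc (pathValue p x u₁),
          mul_assoc (invPathValue p y w), ← mul_assoc (invPathValue p y u₂),
          H.invPathValue_mul_pathValue, ← mul_assoc _ (p _), H.invPathValue_mul_vertex]
    · rw [mk_mul_mk_of_not_comparable _ _ _ _ hc]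
      change 0 = (_ * invPathValue p y _) * (pathValue p x _ * _)
      rw [mul_assoc, ← mul_assoc _ _ (invPathValue p y v₂),
        H.invPathValue_mul_pathValue_of_not_comparable _ _ hc, zero_mul, mul_zero]
  refine ⟨⟨F, hF⟩, ⟨rfl, H.vertex_mul_self, fun a b e => ⟨?_, ?_⟩⟩, ?_⟩
  · change p a * x e * p b = x e
    rw [H.source_mul, H.mul_range]
  · change p b * (y e * p a) = y e
    rw [H.inv_mul_source, H.range_mul_inv]
  · rintro f ⟨f0, fv, fe⟩
    have hu : ∀ {a b : V} (u : Path a b), f (mk u Path.nil) = pathValue p x u := by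
      intro a b u
      induction u with
      | nil => exact fv a
      | @cons b c u e ih =>
        have : mk (u.cons e) Path.nil = mk u Path.nil * edge e := by
          have := mk_mul_mk_left u Path.nil e.toPath Path.nil
          rw [Path.nil_comp] at this
          exact this.symm
        rw [this, map_mul, ih, (fe e).1, pathValue]
    have hv : ∀ {a b : V} (v : Path a b), f (mk Path.nil v) = invPathValue p y v := by
      intro a b v
      induction v with
      | nil => exact fv a
      | @cons b c v e ih =>
        have : mk Path.nil (v.cons e) = edgeInv e * mk Path.nil v := by
          have := mk_mul_mk_right Path.nil Path.nil e.toPath v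
          rw [Path.nil_comp] at this
          exact this.symm
        rw [this, map_mul, ih, (fe e).2, invPathValue]
    ext g
    rcases g with _ | ⟨u, v⟩
    · exact f0
    · have : mk u v = mk u Path.nil * mk Path.nil v :=
        (mk_mul_mk_left u Path.nil Path.nil v).symm
      rw [this, map_mul, hu, hv, ← this]
      rfl

end Lift

end GraphInverseSemigroup

/-! Without edges, G(E) is finite, hence compact. Otherwise every vertex emits and receives an edge,
and every nonzero point is isolated (`isOpen_singleton_mk`). A compact neighbourhood K of 0 is then
open, and a translation pushes only finitely many points of K out of K, since these points form a
compact set of isolated points. It remains to see that such a K is finite, so that 0 is isolated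
too, or cofinite, so that the space is compact. This is pure combinatorics.

The nonzero elements split into finitely many blocks, one for each common range c; a block is a
square P × P, where P is the set of paths ending at c. Multiplication makes any two rows of K in a
block almost equal, likewise any two columns, and makes K almost invariant under lengthening u at
its source. Following the lengthening map to infinity then gives the same answer from every starting
point, and a point that disagrees with it has one of finitely many exceptional points ahead on its
orbit (`finite_or_finite_compl_of_almost_invariant`). Strong connectivity carries the answer from
block to block. -/

open Filter

/-! ### Almost invariant subsets of a square -/

section Grid

variable {P : Type*} {σ : P → P} {l : P → ℕ}

theorem eventually_notMem_iterate (hl : ∀ u, l u < l (σ u)) {D : Set P} (hD : D.Finite) (u : P) :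
    ∀ᶠ i in atTop, σ^[i] u ∉ D := by
  have hinj : Function.Injective fun i => σ^[i] u := by
    have : StrictMono fun i => l (σ^[i] u) := strictMono_nat_of_lt_succ fun i => by
      simpa only [Function.iterate_succ_apply'] using hl _
    exact fun i j h => this.injective (congrArg l h)
  have := hinj.tendsto_cofinite.eventually hD.compl_mem_cofinite
  rwa [Nat.cofinite_eq_atTop] at this

/-- The orbit of a point outside `B` passes through an exceptional point just before it first enters
`B`. An exceptional point has finitely many ancestors: injectivity allows one for each number of
steps, and the growth of `l` bounds that number. -/
theorem finite_compl_of_exists_iterate_mem (hσ : Function.Injective σ) (hl : ∀ u, l u < l (σ u))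
    {B : Set (P × P)} (h : {p : P × P | ¬((σ p.1, p.2) ∈ B ↔ p ∈ B)}.Finite)
    (hB : ∀ u v, ∃ i, (σ^[i] u, v) ∈ B) : Bᶜ.Finite := by
  have hle : ∀ i u, i ≤ l (σ^[i] u) := by
    intro i u
    induction i with
    | zero => exact Nat.zero_le _
    | succ i ih =>
      rw [Function.iterate_succ_apply']
      exact ih.trans_lt (hl _)
  have hfin : ∀ p : P × P, {q : P × P | ∃ i, (σ^[i] q.1, q.2) = p}.Finite := by
    intro p
    refine Set.Finite.subset ((Set.finite_Iic (l p.1)).biUnion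
      (t := fun i => {q : P × P | (σ^[i] q.1, q.2) = p}) fun i _ => ?_) ?_
    · refine Set.Subsingleton.finite fun q hq q' hq' => ?_
      have := (Set.mem_ofPred.1 hq).trans (Set.mem_ofPred.1 hq').symm
      rw [Prod.mk.injEq] at this
      exact Prod.ext (hσ.iterate i this.1) this.2
    · rintro q ⟨i, rfl⟩
      exact Set.mem_biUnion (hle i q.1) rfl
  refine (h.biUnion fun p _ => hfin p).subset fun q hq => ?_
  classical
  have hex := hB q.1 q.2
  obtain ⟨n, hn⟩ : ∃ n, Nat.find hex = n + 1 := by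
    refine Nat.exists_eq_succ_of_ne_zero fun h0 => hq ?_
    have := Nat.find_spec hex
    rwa [h0] at this
  have h1 := Nat.find_spec hex
  have h2 := Nat.find_min hex (m := n) (by omega)
  rw [hn, Function.iterate_succ_apply'] at h1
  exact Set.mem_biUnion (x := (σ^[n] q.1, q.2)) (fun hiff => h2 (hiff.1 h1)) ⟨n, rfl⟩

theorem eventually_or_eventually_not {Q : ℕ → Prop} (h : ∀ᶠ i in atTop, Q (i + 1) ↔ Q i) :
    (∀ᶠ i in atTop, Q i) ∨ ∀ᶠ i in atTop, ¬ Q i := by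
  obtain ⟨n, hn⟩ := eventually_atTop.1 h
  have key : ∀ i ≥ n, Q i ↔ Q n := fun i hi => by
    induction i, hi using Nat.le_induction with
    | base => rfl
    | succ i hi ih => exact (hn i hi).trans ih
  by_cases hQ : Q n
  · exact Or.inl (eventually_atTop.2 ⟨n, fun i hi => (key i hi).2 hQ⟩)
  · exact Or.inr (eventually_atTop.2 ⟨n, fun i hi => mt (key i hi).1 hQ⟩)

/-- A subset of a square that is almost invariant under a free injective map of either coordinate,
any two rows and any two columns of which are almost equal, is finite or cofinite. -/
theorem finite_or_finite_compl_of_almost_invariant (hσ : Function.Injective σ)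
    (hl : ∀ u, l u < l (σ u)) {A : Set (P × P)}
    (h₁ : {p : P × P | ¬((σ p.1, p.2) ∈ A ↔ p ∈ A)}.Finite)
    (hr : ∀ u u', {v | ¬((u, v) ∈ A ↔ (u', v) ∈ A)}.Finite)
    (hc : ∀ v v', {u | ¬((u, v) ∈ A ↔ (u, v') ∈ A)}.Finite) : A.Finite ∨ Aᶜ.Finite := by
  -- The limit along the first coordinate does not depend on `v`, because an orbit leaves the finite
  -- set on which two columns differ. The next claim is the same for rows.
  have hG : ∀ u v v', (∀ᶠ i in atTop, (σ^[i] u, v) ∈ A) ↔ ∀ᶠ i in atTop, (σ^[i] u, v') ∈ A :=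
    fun u v v' => eventually_congr <| (eventually_notMem_iterate hl (hc v v') u).mono
      fun i hi => not_not.1 hi
  have hH : ∀ u u' v, (∀ᶠ j in atTop, (u, σ^[j] v) ∈ A) ↔ ∀ᶠ j in atTop, (u', σ^[j] v) ∈ A :=
    fun u u' v => eventually_congr <| (eventually_notMem_iterate hl (hr u u') v).mono
      fun i hi => not_not.1 hi
  have hGH : ∀ u v, (∀ᶠ i in atTop, (σ^[i] u, v) ∈ A) ↔ ∀ᶠ j in atTop, (u, σ^[j] v) ∈ A := by
    intro u v
    have : ∀ᶠ j in atTop, ((u, σ^[j] v) ∈ A ↔ ∀ᶠ i in atTop, (σ^[i] u, v) ∈ A) := by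
      -- For large `j` no exceptional point has second coordinate `σ^[j] v`, so membership in `A` is
      -- constant along the whole orbit of `u` at that height.
      filter_upwards [eventually_notMem_iterate hl (h₁.image Prod.snd) v] with j hj
      have hj' : ∀ i, (σ^[i] u, σ^[j] v) ∈ A ↔ (u, σ^[j] v) ∈ A := by
        intro i
        induction i with
        | zero => rfl
        | succ i ih =>
          rw [Function.iterate_succ_apply', ← ih]
          by_contra hne
          exact hj ⟨(σ^[i] u, σ^[j] v), hne, rfl⟩
      rw [hG u v (σ^[j] v)]
      simp only [hj', eventually_const]
    rw [eventually_congr this, eventually_const]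
  have hconst : ∀ u v u' v',
      (∀ᶠ i in atTop, (σ^[i] u, v) ∈ A) ↔ ∀ᶠ i in atTop, (σ^[i] u', v') ∈ A := fun u v u' v' => by
    rw [hG u v v', hGH, hH u u', ← hGH]
  have hdich : ∀ u v, (∀ᶠ i in atTop, (σ^[i] u, v) ∈ A) ∨ ∀ᶠ i in atTop, (σ^[i] u, v) ∉ A := by
    intro u v
    have hinj : Function.Injective fun w : P => (w, v) := fun _ _ h => (Prod.mk.inj h).1
    refine eventually_or_eventually_not
      ((eventually_notMem_iterate hl (h₁.preimage hinj.injOn) u).mono fun i hi => ?_)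
    rw [Function.iterate_succ_apply']
    exact not_not.1 hi
  by_cases h : ∃ u v, ∀ᶠ i in atTop, (σ^[i] u, v) ∈ A
  · obtain ⟨u₀, v₀, h⟩ := h
    exact Or.inr <| finite_compl_of_exists_iterate_mem hσ hl h₁
      fun u v => ((hconst u₀ v₀ u v).1 h).exists
  · left
    rw [← compl_compl A]
    refine finite_compl_of_exists_iterate_mem hσ hl ?_
      fun u v => ((hdich u v).resolve_left fun h' => h ⟨u, v, h'⟩).exists
    simpa only [Set.mem_compl_iff, not_iff_not] using h₁

end Grid

/-! ### Blocks of G(E) and prefixes of paths -/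

namespace GraphInverseSemigroup

open Quiver

variable {V : Type u} [Quiver.{v} V]

theorem mk_ne_zero {a b c : V} (u : Path a c) (v : Path b c) : mk u v ≠ 0 := by
  rintro ⟨⟩

/-- The element `u v⁻¹` for a pair of paths with range `c`. -/
def ofPair {c : V} (p : (Σ a, Path a c) × Σ a, Path a c) : GraphInverseSemigroup V :=
  mk p.1.2 p.2.2

theorem ofPair_injective (c : V) : Function.Injective (ofPair (c := c)) := by
  rintro ⟨⟨a, u⟩, ⟨b, v⟩⟩ ⟨⟨a', u'⟩, ⟨b', v'⟩⟩ h
  cases h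
  rfl

theorem finite_prefixes {a b : V} (u : Path a b) :
    {p : Σ d, Path a d | ∃ w : Path p.1 b, u = p.2.comp w}.Finite := by
  induction u with
  | nil =>
    refine (Set.finite_singleton ⟨a, Path.nil⟩).subset ?_
    rintro ⟨d, p⟩ ⟨w, hw⟩
    dsimp only at w hw
    have hl := congrArg Path.length hw
    rw [Path.length_comp, Path.length_nil] at hl
    obtain rfl := Path.eq_of_length_zero p (by omega)
    obtain rfl := Path.eq_nil_of_length_zero p (by omega)
    rfl
  | @cons b c u e ih =>
    refine (ih.insert ⟨c, u.cons e⟩).subset ?_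
    rintro ⟨d, p⟩ ⟨w, hw⟩
    dsimp only at w hw
    cases w with
    | nil => exact Or.inl (by rw [hw]; rfl)
    | cons w f =>
      simp only [Path.comp_cons, Path.cons.injEq] at hw
      obtain ⟨rfl, hw, -⟩ := hw
      exact Or.inr ⟨w, hw.eq⟩

/-- Serves to show that prepending a chosen edge is injective even though the edge depends on the
path: all the prepended pieces have length one. -/
theorem eq_of_comp_eq_comp {a a' b b' c : V} {p : Path b a} {p' : Path b' a'} {q : Path a c}
    {q' : Path a' c} (hl : p.length = p'.length)
    (h : (⟨b, p.comp q⟩ : Σ d, Path d c) = ⟨b', p'.comp q'⟩) :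
    (⟨a, q⟩ : Σ d, Path d c) = ⟨a', q'⟩ := by
  simp only [Sigma.mk.injEq] at h
  obtain ⟨rfl, h⟩ := h
  have h := h.eq
  have hw : ∃ w : Path a a', p' = p.comp w ∧ w.length = 0 := by
    rcases Path.prefix_or_prefix h with ⟨w, rfl⟩ | ⟨w, rfl⟩ <;> rw [Path.length_comp] at hl
    · exact ⟨w, rfl, by omega⟩
    · obtain rfl := Path.eq_of_length_zero w (by omega)
      obtain rfl := Path.eq_nil_of_length_zero w (by omega)
      exact ⟨Path.nil, rfl, rfl⟩
  obtain ⟨w, rfl, hw⟩ := hw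
  obtain rfl := Path.eq_of_length_zero w hw
  obtain rfl := Path.eq_nil_of_length_zero w hw
  rw [Path.comp_nil, Path.comp_inj_right] at h
  rw [h]

theorem infinite_paths_to (hin : ∀ a : V, ∃ b, Nonempty (b ⟶ a)) (c : V) :
    Infinite (Σ a, Path a c) := by
  choose b e using hin
  by_contra h
  rw [not_infinite_iff_finite] at h
  obtain ⟨i, hi⟩ := (eventually_notMem_iterate (l := fun u => u.2.length)
    (σ := fun u : Σ a, Path a c => ⟨b u.1, (e u.1).some.toPath.comp u.2⟩)
    (fun u => by simp) Set.finite_univ ⟨c, Path.nil⟩).exists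
  exact hi trivial

theorem finite_mk_prefixes {a b c d : V} (x : Path a c) (y : Path b d) :
    {t : GraphInverseSemigroup V | ∃ (e : V) (u : Path a e) (v : Path b e) (w : Path e c)
      (w' : Path e d), t = mk u v ∧ x = u.comp w ∧ y = v.comp w'}.Finite := by
  classical
  let F : (Σ d, Path a d) × (Σ d, Path b d) → GraphInverseSemigroup V := fun p =>
    if h : p.2.1 = p.1.1 then mk p.1.2 (h ▸ p.2.2) else 0
  refine (((finite_prefixes x).prod (finite_prefixes y)).image F).subset ?_
  rintro _ ⟨e, u, v, w, w', rfl, hx, hy⟩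
  exact ⟨(⟨e, u⟩, ⟨e, v⟩), ⟨⟨w, hx⟩, ⟨w', hy⟩⟩, dif_pos rfl⟩

theorem finite_of_isEmpty_hom [Finite V] (h : ∀ a b : V, IsEmpty (a ⟶ b)) :
    Finite (GraphInverseSemigroup V) := by
  refine Set.finite_univ_iff.1 (((Set.finite_range (vertex (V := V))).insert 0).subset ?_)
  rintro (_ | ⟨u, v⟩) -
  · exact Or.inl rfl
  · cases u with
    | cons u e => exact (h _ _).elim e
    | nil =>
      cases v with
      | cons v e => exact (h _ _).elim e
      | nil => exact Or.inr ⟨_, rfl⟩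

theorem isOpen_singleton_of_finite {X : Type*} [TopologicalSpace X] [T1Space X] {U : Set X}
    (hU : IsOpen U) (hfin : U.Finite) {x : X} (hx : x ∈ U) : IsOpen {x} := by
  have : ({x} : Set X) = U \ (U \ {x}) := by
    rw [Set.sdiff_sdiff_right_self, Set.inter_eq_right.2 (Set.singleton_subset_iff.2 hx)]
  rw [this]
  exact hU.sdiff (hfin.subset Set.sdiff_subset).isClosed

/-! ### Nonzero elements are isolated -/

section Topology

variable [TopologicalSpace (GraphInverseSemigroup V)] [T2Space (GraphInverseSemigroup V)]
  [SeparatelyContinuousMul (GraphInverseSemigroup V)]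

/-- For t = u'v'⁻¹, the condition x⁻¹ty ≠ 0 makes u' comparable with x and v' with y, while xx⁻¹t ≠
t and tyy⁻¹ ≠ t forbid u' to extend x and v' to extend y. So u', v' are prefixes of x, y, which
leaves finitely many t. Taking x and y one edge longer than u and v lets uv⁻¹ itself meet these open
conditions. -/
theorem isOpen_singleton_mk (hout : ∀ a : V, ∃ b, Nonempty (a ⟶ b)) {a b c : V} (u : Path a c)
    (v : Path b c) : IsOpen ({mk u v} : Set (GraphInverseSemigroup V)) := by
  obtain ⟨d, ⟨e⟩⟩ := hout c
  let x := u.comp e.toPath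
  let y := v.comp e.toPath
  let U : Set (GraphInverseSemigroup V) :=
    {t | mk Path.nil x * t * mk y Path.nil ≠ 0} ∩ {t | mk x x * t ≠ t} ∩ {t | t * mk y y ≠ t}
  have hU : IsOpen U := by
    refine (IsOpen.inter ?_ ?_).inter ?_
    · exact isOpen_ne.preimage ((continuous_mul_const _).comp (continuous_const_mul _))
    · exact isOpen_ne_fun (continuous_const_mul _) continuous_id
    · exact isOpen_ne_fun (continuous_mul_const _) continuous_id
  have hfin : U.Finite := by
    refine (finite_mk_prefixes x y).subset ?_
    rintro (_ | ⟨u', v'⟩) ⟨⟨h1, h2⟩, h3⟩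
    · exact absurd ((congrArg (· * _) (mul_zero _)).trans (zero_mul _)) h1
    have hu : Comparable x u' := by
      by_contra hc
      exact h1 (by rw [mk_mul_mk_of_not_comparable _ _ _ _ hc, zero_mul])
    have hv : Comparable v' y := by
      by_contra hc
      exact h1 (by rw [mul_assoc, mk_mul_mk_of_not_comparable _ _ _ _ hc, mul_zero])
    refine hu.elim ?_ ?_
    · rintro rfl w hw
      obtain rfl := hw.eq
      exact absurd (mk_mul_mk_left _ _ _ _) h2
    rintro rfl w hw
    refine hv.elim ?_ ?_
    · rintro rfl w' hw'
      exact ⟨_, u', v', w, w', rfl, hw.eq, hw'.eq⟩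
    · rintro rfl w' hw'
      obtain rfl := hw'.eq
      exact absurd (mk_mul_mk_right _ _ _ _) h3
  have hmem : mk u v ∈ U := by
    have hlen : ∀ {a' : V} (q : Path a' c), (⟨d, q.comp e.toPath⟩ : Σ d, Path a' d) ≠ ⟨c, q⟩ := by
      intro a' q h
      have := congrArg (fun p : Σ d, Path a' d => p.2.length) h
      simp at this
    refine ⟨⟨?_, fun h => ?_⟩, fun h => ?_⟩
    · change mk Path.nil x * mk u v * mk y Path.nil ≠ 0
      have h := mk_mul_mk_left (Path.nil : Path d d) y Path.nil Path.nil
      rw [Path.comp_nil] at h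
      rw [mk_mul_mk_right, h]
      exact mk_ne_zero _ _
    · rw [mk_mul_mk_right] at h
      simp only [mk.injEq] at h
      exact hlen u (Sigma.ext h.2.2.1 h.2.2.2.1)
    · rw [mk_mul_mk_left] at h
      simp only [mk.injEq] at h
      exact hlen u (Sigma.ext h.2.2.1 h.2.2.2.1)
  exact isOpen_singleton_of_finite hU hfin hmem

theorem isOpen_singleton_of_ne_zero (hout : ∀ a : V, ∃ b, Nonempty (a ⟶ b))
    {t : GraphInverseSemigroup V} (ht : t ≠ 0) : IsOpen {t} := by
  rcases t with _ | ⟨u, v⟩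
  · exact absurd rfl ht
  · exact isOpen_singleton_mk hout u v

/-- A continuous self-map fixing `0` moves only finitely many points out of a compact open
neighbourhood of `0`. -/
theorem finite_inter_preimage_compl (hout : ∀ a : V, ∃ b, Nonempty (a ⟶ b))
    {K : Set (GraphInverseSemigroup V)} (hK : IsCompact K) (hKo : IsOpen K) (h0 : 0 ∈ K)
    {f : GraphInverseSemigroup V → GraphInverseSemigroup V} (hf : Continuous f) (hf0 : f 0 = 0) :
    {t | t ∈ K ∧ f t ∉ K}.Finite := by
  -- This set is closed in `K` and misses 0, so it is compact and discrete.
  have hc : IsCompact {t | t ∈ K ∧ f t ∉ K} :=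
    hK.inter_right (hKo.isClosed_compl.preimage hf)
  refine hc.finite (isDiscrete_iff_forall_mem_exists_isOpen.2 fun t ht => ?_)
  refine ⟨{t}, isOpen_singleton_of_ne_zero hout ?_, Set.singleton_inter_of_mem ht⟩
  rintro rfl
  exact ht.2 (hf0.symm ▸ h0)

end Topology

/-! ### Almost invariant sets are finite or cofinite -/

section AlmostInvariant

variable {K : Set (GraphInverseSemigroup V)}

/-- Every left or right translation moves only finitely many points of `K` out of `K`. -/
structure AlmostInvariant (K : Set (GraphInverseSemigroup V)) : Prop where
  intro ::
  left (x : GraphInverseSemigroup V) : {t | t ∈ K ∧ x * t ∉ K}.Finite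
  right (x : GraphInverseSemigroup V) : {t | t ∈ K ∧ t * x ∉ K}.Finite

/-- If just one of `F i`, `G i` lies in `K`, then `f` or `g` moves it out of `K`; each does so for
finitely many points. -/
theorem finite_setOf_not_mem_iff {ι : Type*} {s : Set ι}
    {F G : ι → GraphInverseSemigroup V} (hF : Function.Injective F) (hG : Function.Injective G)
    {f g : GraphInverseSemigroup V → GraphInverseSemigroup V}
    (hf : {t | t ∈ K ∧ f t ∉ K}.Finite) (hg : {t | t ∈ K ∧ g t ∉ K}.Finite)
    (hFG : ∀ i ∈ s, f (F i) = G i) (hGF : ∀ i ∈ s, g (G i) = F i) :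
    {i | i ∈ s ∧ ¬ (G i ∈ K ↔ F i ∈ K)}.Finite := by
  refine ((hf.preimage hF.injOn).union (hg.preimage hG.injOn)).subset ?_
  rintro i ⟨his, hi⟩
  by_cases h : F i ∈ K
  · exact Or.inl ⟨h, by rw [hFG i his]; exact fun h' => hi ⟨fun _ => h, fun _ => h'⟩⟩
  · refine Or.inr ⟨?_, by rwa [hGF i his]⟩
    by_contra h'
    exact hi ⟨fun h'' => absurd h'' h', fun h'' => absurd h'' h⟩

theorem mk_nil_mul_mk {a b c d : V} (x : Path b a) (u : Path a c) (v : Path d c) :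
    mk x Path.nil * mk u v = mk (x.comp u) v := by
  simpa using mk_mul_mk_left x Path.nil u v

/-- Left multiplication by uu'⁻¹ carries row u' onto row u, and u'u⁻¹ carries it back. -/
theorem AlmostInvariant.finite_row (hK : AlmostInvariant K) {c : V} (u u' : Σ a, Path a c) :
    {v | ¬ (ofPair (u, v) ∈ K ↔ ofPair (u', v) ∈ K)}.Finite := by
  have hinj : ∀ u : Σ a, Path a c, Function.Injective fun v => ofPair (u, v) :=
    fun u v v' h => (Prod.mk.inj (ofPair_injective c h)).2
  have := finite_setOf_not_mem_iff (s := Set.univ) (hinj u') (hinj u)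
    (hK.left (mk u.2 u'.2)) (hK.left (mk u'.2 u.2))
    (fun v _ => mk_mul_mk_left u.2 u'.2 Path.nil v.2)
    (fun v _ => mk_mul_mk_left u'.2 u.2 Path.nil v.2)
  simpa only [Set.mem_univ, true_and] using this

theorem AlmostInvariant.finite_column (hK : AlmostInvariant K) {c : V} (v v' : Σ a, Path a c) :
    {u | ¬ (ofPair (u, v) ∈ K ↔ ofPair (u, v') ∈ K)}.Finite := by
  have hinj : ∀ v : Σ a, Path a c, Function.Injective fun u => ofPair (u, v) :=
    fun v u u' h => (Prod.mk.inj (ofPair_injective c h)).1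
  have := finite_setOf_not_mem_iff (s := Set.univ) (hinj v') (hinj v)
    (hK.right (mk v'.2 v.2)) (hK.right (mk v.2 v'.2))
    (fun u _ => mk_mul_mk_left u.2 v'.2 Path.nil v.2)
    (fun u _ => mk_mul_mk_left u.2 v.2 Path.nil v'.2)
  simpa only [Set.mem_univ, true_and] using this

theorem AlmostInvariant.finite_preimage_ofPair_or_compl [Finite V] (hK : AlmostInvariant K)
    (hin : ∀ a : V, ∃ b, Nonempty (b ⟶ a)) (c : V) :
    (ofPair (c := c) ⁻¹' K).Finite ∨ (ofPair (c := c) ⁻¹' K)ᶜ.Finite := by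
  choose b e using hin
  let x : ∀ a, Path (b a) a := fun a => (e a).some.toPath
  let σ : (Σ a, Path a c) → Σ a, Path a c := fun u => ⟨b u.1, (x u.1).comp u.2⟩
  have hl : ∀ u, u.2.length < (σ u).2.length := fun u => by
    simp [σ, x]
  have hσ : Function.Injective σ := by
    rintro ⟨a, u⟩ ⟨a', u'⟩ h
    exact eq_of_comp_eq_comp (by simp [x]) h
  refine finite_or_finite_compl_of_almost_invariant hσ hl ?_ hK.finite_row hK.finite_column
  have hσ' : Function.Injective fun p : (Σ a, Path a c) × Σ a, Path a c =>
      ofPair (σ p.1, p.2) := (ofPair_injective c).comp (hσ.prodMap Function.injective_id)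
  -- The edge prepended by `σ` depends on the source of the path, so a single translation realises
  -- `σ` only on paths with a given source `a`. There are finitely many sources.
  refine (Set.finite_iUnion fun a => finite_setOf_not_mem_iff
    (s := {p : (Σ a, Path a c) × Σ a, Path a c | p.1.1 = a}) (ofPair_injective c) hσ'
    (hK.left (mk (x a) Path.nil)) (hK.left (mk Path.nil (x a))) ?_ ?_).subset
    fun p hp => Set.mem_iUnion.2 ⟨p.1.1, rfl, hp⟩
  · rintro p rfl
    exact mk_nil_mul_mk _ _ _
  · rintro p rfl
    refine (mk_mul_mk_left Path.nil (x p.1.1) p.1.2 p.2.2).trans ?_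
    rw [Path.nil_comp]
    rfl

theorem AlmostInvariant.finite_or_finite_compl [Finite V] (hK : AlmostInvariant K)
    (hV : IsSStronglyConnected V) : K.Finite ∨ Kᶜ.Finite := by
  have hin : ∀ a : V, ∃ b, Nonempty (b ⟶ a) := fun a => by
    obtain ⟨p, hp⟩ := hV a a
    cases p with
    | nil => simp at hp
    | cons p e => exact ⟨_, ⟨e⟩⟩
  have hcover : ∀ t : GraphInverseSemigroup V, t ≠ 0 → ∃ c p, ofPair (c := c) p = t := by
    rintro (_ | ⟨u, v⟩) ht
    · exact absurd rfl ht
    · exact ⟨_, (⟨_, u⟩, ⟨_, v⟩), rfl⟩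
  have hfin : ∀ B : Set (GraphInverseSemigroup V),
      (∀ c, (ofPair (c := c) ⁻¹' B).Finite) → B.Finite := by
    intro B hB
    refine ((Set.finite_iUnion fun c => (hB c).image ofPair).insert 0).subset fun t ht => ?_
    by_cases h0 : t = 0
    · exact Or.inl h0
    · obtain ⟨c, p, rfl⟩ := hcover t h0
      exact Or.inr (Set.mem_iUnion.2 ⟨c, p, ht, rfl⟩)
  by_cases h : ∃ c, (ofPair (c := c) ⁻¹' K)ᶜ.Finite
  · obtain ⟨c, hc⟩ := h
    refine Or.inr (hfin _ fun d => (hK.finite_preimage_ofPair_or_compl hin d).resolve_left fun hd => ?_)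
    -- Left multiplication by x⁻¹ sends v⁻¹ in block `c` to (vx)⁻¹ in block `d`. If `K` had almost
    -- all of block `c` and almost none of block `d`, infinitely many points would leave `K`.
    obtain ⟨x, -⟩ := hV c d
    have := infinite_paths_to hin c
    have hinj : Function.Injective fun v : Σ a, Path a c => ofPair (⟨c, Path.nil⟩, v) :=
      fun v v' h => (Prod.mk.inj (ofPair_injective c h)).2
    have hinj' : Function.Injective fun v : Σ a, Path a c =>
        ofPair (⟨d, Path.nil⟩, ⟨v.1, v.2.comp x⟩) := by
      rintro ⟨a, v⟩ ⟨a', v'⟩ h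
      have := (Prod.mk.inj (ofPair_injective d h)).2
      simp only [Sigma.mk.injEq] at this
      obtain ⟨rfl, this⟩ := this
      rw [heq_eq_eq, Path.comp_inj_left] at this
      rw [this]
    have h1 : {v : Σ a, Path a c | ofPair (⟨c, Path.nil⟩, v) ∉ K}.Finite :=
      hc.preimage (f := fun v : Σ a, Path a c => ((⟨c, Path.nil⟩ : Σ a, Path a c), v)) (fun v _ v' _ h => (Prod.mk.inj h).2)
    have h2 := (hK.left (mk Path.nil x)).preimage hinj.injOn
    have h3 : {v : Σ a, Path a c | ofPair (⟨d, Path.nil⟩, ⟨v.1, v.2.comp x⟩) ∈ K}.Finite :=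
      (hd.image ofPair).preimage hinj'.injOn |>.subset fun v hv => ⟨_, hv, rfl⟩
    refine Set.infinite_univ (((h1.union h2).union h3).subset fun v _ => ?_)
    by_cases hv : ofPair (⟨c, Path.nil⟩, v) ∈ K
    · by_cases hv' : ofPair (⟨d, Path.nil⟩, ⟨v.1, v.2.comp x⟩) ∈ K
      · exact Or.inr hv'
      · refine Or.inl (Or.inr ⟨hv, ?_⟩)
        have := mk_mul_mk_right Path.nil Path.nil x v.2
        rw [Path.nil_comp] at this
        exact this.symm ▸ hv'
    · exact Or.inl (Or.inl hv)
  · push Not at h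
    exact Or.inl (hfin _ fun c => (hK.finite_preimage_ofPair_or_compl hin c).resolve_right (h c))

end AlmostInvariant

end GraphInverseSemigroup

/-! ### The dichotomy -/

theorem mainTheorem1 (V : Type u) [Quiver.{v} V] [Finite V] (hV : Quiver.IsStronglyConnected V)
    [TopologicalSpace (GraphInverseSemigroup V)] [T2Space (GraphInverseSemigroup V)]
    [LocallyCompactSpace (GraphInverseSemigroup V)]
    [SeparatelyContinuousMul (GraphInverseSemigroup V)] :
    CompactSpace (GraphInverseSemigroup V) ∨ DiscreteTopology (GraphInverseSemigroup V) := by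
  by_cases hE : ∃ a b : V, Nonempty (a ⟶ b)
  · obtain ⟨a, b, ⟨e⟩⟩ := hE
    -- A single edge yields paths of positive length between any two vertices, so every vertex emits
    -- and receives an edge.
    have hV' := hV.isSStronglyConnected_of_hom e
    have hout : ∀ a : V, ∃ b, Nonempty (a ⟶ b) := fun a => by
      obtain ⟨p, hp⟩ := hV' a a
      obtain ⟨b, f, -⟩ := (Quiver.Path.length_ne_zero_iff_eq_comp p).1 hp.ne'
      exact ⟨b, ⟨f⟩⟩
    obtain ⟨K, hK, hK0⟩ := exists_compact_mem_nhds (0 : GraphInverseSemigroup V)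
    have h0 : 0 ∈ K := mem_of_mem_nhds hK0
    have hKo : IsOpen K := isOpen_iff_mem_nhds.2 fun t ht => by
      by_cases h : t = 0
      · rwa [h]
      · exact Filter.mem_of_superset
          ((GraphInverseSemigroup.isOpen_singleton_of_ne_zero hout h).mem_nhds rfl)
          (Set.singleton_subset_iff.2 ht)
    have hinv : GraphInverseSemigroup.AlmostInvariant K :=
      ⟨fun x => GraphInverseSemigroup.finite_inter_preimage_compl hout hK hKo h0
        (continuous_const_mul x) (mul_zero x),
      fun x => GraphInverseSemigroup.finite_inter_preimage_compl hout hK hKo h0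
        (continuous_mul_const x) (zero_mul x)⟩
    rcases hinv.finite_or_finite_compl hV' with h | h
    · right
      refine discreteTopology_iff_isOpen_singleton.2 fun t => ?_
      by_cases ht : t = 0
      · subst ht
        exact GraphInverseSemigroup.isOpen_singleton_of_finite hKo h h0
      · exact GraphInverseSemigroup.isOpen_singleton_of_ne_zero hout ht
    · left
      exact ⟨by simpa using hK.union h.isCompact⟩
  · push Not at hE
    have := GraphInverseSemigroup.finite_of_isEmpty_hom fun a b : V => hE a b
    exact Or.inl inferInstance
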